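/- All graphs are finite, simple and connected. A graph-labelled tree $T_{\mathcal F}$ is obtained from a finite tree $T$ by replacing each internal node $\alpha$ of degree $k\ge 2$ by a graph $G_\alpha$ on $k$ vertices, called a component, where the vertices of $G_\alpha$ are in bijection with the tree edges at $\alpha$ and the end $\alpha$ of each such edge is replaced by the corresponding vertex of $G_\alpha$. The edges of the graphs $G_\alpha$ are the $\mathcal F$-edges of $T_{\mathcal F}$, the remaining ones its $T$-edges; a $T$-edge joining two components is a marked edge. An alternated path is a path in $T_{\mathcal F}$ that alternates between $T$-edges and $\mathcal F$-edges. The accessibility graph of $T_{\mathcal F}$ has as vertices the leaves of $T$ (the pendant vertices of $T_{\mathcal F}$), two distinct ones being adjacent if and only if they are joined by an alternated path. A split of a connected graph is a partition $\{V_1,V_2\}$ of its vertex set with $|V_1|,|V_2|\ge 2$ such that every vertex of $V_2$ having a neighbour in $V_1$ is adjacent to every vertex of $V_1$ having a neighbour in $V_2$; a connected graph is prime if it has no split. A star is a tree on $n$ vertices with a vertex, its center, of degree $n-1$; its other vertices are its leaves. The minimal split-decomposition tree of $G$ is the (unique) graph-labelled tree $T_{\mathcal F}$ such that (i) its accessibility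 graph is isomorphic to $G$; (ii) every component is a clique, a star or a prime graph; (iii) every component has at least three vertices; (iv) no marked edge joins two clique components; (v) no marked edge joins the center of a star component to a leaf of another star component. A graph $G$ is distance-hereditary if in every connected induced subgraph the distance between any two vertices equals their distance in $G$. An s-leaf is a leaf of a star component of $T_{\mathcal F}$. An s-leaf-path in $T_{\mathcal F}$ is an alternated path whose endpoints are s-leaves of two distinct star components and which contains no edge of either of these two components. **Theorem.** Let $G$ be a distance-hereditary graph and let $T_{\mathcal F}$ be a minimal split-decomposition tree of $G$. Then $G$ contains an induced path $P_4$ on four vertices if and only if there exists an s-leaf-path in $T_{\mathcal F}$. -/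

import Mathlib

universe u v

/-- The neighbourhood of a set `A` of vertices: the vertices outside `A` that are adjacent to some
vertex of `A`. -/
def SimpleGraph.setNeighborhood {V : Type u} (G : SimpleGraph V) (A : Set V) : Set V :=
  (⋃ a ∈ A, G.neighborSet a) \ A

/-- `{A, Aᶜ}` is a split of `G`: both sides have at least two vertices, and every vertex of `N(A)`
is adjacent to every vertex of `N(Aᶜ)`. -/
def SimpleGraph.IsSplit {V : Type u} (G : SimpleGraph V) (A : Set V) : Prop :=
  A.Nontrivial ∧ Aᶜ.Nontrivial ∧
    ∀ x ∈ G.setNeighborhood A, ∀ y ∈ G.setNeighborhood Aᶜ, G.Adj x y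

/-- A prime graph: a connected graph without any split. -/
def SimpleGraph.IsSplitPrime {V : Type u} (G : SimpleGraph V) : Prop :=
  G.Connected ∧ ∀ A : Set V, ¬ G.IsSplit A

/-- A distance-hereditary graph: in every connected induced subgraph, the distance between any two
vertices is the same as in `G`. -/
def SimpleGraph.IsDistanceHereditary {V : Type u} (G : SimpleGraph V) : Prop :=
  ∀ s : Set V, (G.induce s).Connected →
    ∀ x y : s, (G.induce s).dist x y = G.dist (x : V) (y : V)

/-- A graph-labelled tree: a tree in which every node `α` carries a graph `G_α` with one vertex for
each tree edge incident to `α`; that vertex is named by the other end of the edge.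
(Only the labels of internal nodes carry information: at a leaf the label has a single vertex,
which plays the role of the leaf itself.) -/
structure GraphLabelledTree (N : Type v) where
  /-- the underlying tree -/
  tree : SimpleGraph N
  isTree : tree.IsTree
  /-- the graph inserted at a node -/
  label : ∀ α : N, SimpleGraph (tree.neighborSet α)

namespace GraphLabelledTree

variable {N : Type v} (T : GraphLabelledTree N)

/-- The leaves of the underlying tree (nodes of degree one). -/
def IsLeafNode (α : N) : Prop := (T.tree.neighborSet α).ncard = 1

/-- The internal nodes of the underlying tree (nodes of degree at least two). -/
def IsInternalNode (α : N) : Prop := 2 ≤ (T.tree.neighborSet α).ncard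

/-- The vertices of the graph `T_F`: the oriented tree edge `(α, β)` stands for the vertex of `G_α`
that is attached to the tree edge `αβ` if `α` is internal, and for `α` itself if `α` is a leaf. -/
abbrev Vertex : Type v := T.tree.Dart

/-- The graph `G_α`, placed inside the vertex set of `T_F`. -/
def component (α : N) : SimpleGraph T.Vertex :=
  (T.label α).map (T.tree.dartOfNeighborSet α)

/-- The `F`-edges: all edges of the graphs `G_α`. -/
def fGraph : SimpleGraph T.Vertex := ⨆ α : N, T.component α

/-- The `T`-edges: the two vertices of `T_F` attached to the same tree edge are adjacent. -/
def tGraph : SimpleGraph T.Vertex where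
  Adj x y := y = x.symm
  symm := ⟨by rintro x y rfl; exact x.symm_symm.symm⟩
  loopless := ⟨fun x h => x.symm_ne h.symm⟩

/-- The graph-labelled tree `T_F` as a graph: its edges are the `T`-edges and the `F`-edges. -/
def graph : SimpleGraph T.Vertex := T.tGraph ⊔ T.fGraph

/-- An alternated path of `T_F`: a path along which `T`-edges and `F`-edges alternate. -/
def IsAlternatedPath {x y : T.Vertex} (p : T.graph.Walk x y) : Prop :=
  p.IsPath ∧
    p.edges.IsChain fun e f =>
      (e ∈ T.tGraph.edgeSet ∧ f ∈ T.fGraph.edgeSet) ∨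
      (e ∈ T.fGraph.edgeSet ∧ f ∈ T.tGraph.edgeSet)

/-- The accessibility graph: its vertices are the pendant vertices of `T_F` (that is, the leaves of
the tree), and two of them are adjacent if they are joined by an alternated path. -/
def accessibilityGraph : SimpleGraph {x : T.Vertex // T.IsLeafNode x.fst} where
  Adj x y := x ≠ y ∧ ∃ p : T.graph.Walk x.1 y.1, T.IsAlternatedPath p
  symm := ⟨by
    rintro x y ⟨hne, p, hp, hc⟩
    refine ⟨hne.symm, p.reverse, hp.reverse, ?_⟩
    rw [SimpleGraph.Walk.edges_reverse, List.isChain_reverse]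
    exact hc.imp fun e f h => h.symm.imp And.symm And.symm⟩
  loopless := ⟨fun _ h => h.1 rfl⟩

/-- The split component at `α` is a clique. -/
def IsCliqueNode (α : N) : Prop := T.IsInternalNode α ∧ T.label α = ⊤

/-- The vertex `x` of `T_F` is the center of a star component. -/
def IsCenter (x : T.Vertex) : Prop :=
  T.IsInternalNode x.fst ∧ T.label x.fst = SimpleGraph.starGraph ⟨x.snd, x.adj⟩

/-- The vertex `x` of `T_F` is an s-leaf, that is, a leaf of a star component. -/
def IsSLeaf (x : T.Vertex) : Prop :=
  T.IsInternalNode x.fst ∧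
    ∃ c, T.label x.fst = SimpleGraph.starGraph c ∧ (⟨x.snd, x.adj⟩ : T.tree.neighborSet x.fst) ≠ c

/-- `T` is a minimal split-decomposition tree of `G`. A marked edge is a `T`-edge `{x, x.symm}`
joining two split components. -/
structure IsMinimalSplitDecompositionTree {V : Type u} (G : SimpleGraph V) : Prop where
  /-- the accessibility graph is isomorphic to `G` -/
  accessibility_iso : Nonempty (T.accessibilityGraph ≃g G)
  /-- every split component is a clique, a star or a prime graph -/
  clique_or_star_or_prime : ∀ α, T.IsInternalNode α →
    T.label α = ⊤ ∨ (∃ c, T.label α = SimpleGraph.starGraph c) ∨ (T.label α).IsSplitPrime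
  /-- every split component has at least three vertices -/
  three_le_card : ∀ α, T.IsInternalNode α → 3 ≤ (T.tree.neighborSet α).ncard
  /-- no marked edge joins two clique components -/
  no_clique_clique : ∀ x : T.Vertex, ¬ (T.IsCliqueNode x.fst ∧ T.IsCliqueNode x.symm.fst)
  /-- no marked edge joins the center of a star component to a leaf of another one -/
  no_center_sLeaf : ∀ x : T.Vertex, ¬ (T.IsCenter x ∧ T.IsSLeaf x.symm)

/-- An s-leaf-path: an alternated path whose endpoints are s-leaves of two star components and which
contains no edge of either of these two components. -/
def IsSLeafPath {x y : T.Vertex} (p : T.graph.Walk x y) : Prop :=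
  T.IsAlternatedPath p ∧ T.IsSLeaf x ∧ T.IsSLeaf y ∧ x.fst ≠ y.fst ∧
    ∀ e ∈ p.edges, e ∉ (T.component x.fst).edgeSet ∧ e ∉ (T.component y.fst).edgeSet

end GraphLabelledTree

/-! An alternated path never backtracks in the tree, so two leaves are adjacent in the accessibility
graph exactly when, at each node strictly between them, the two directions leading to them are
adjacent in the label (`Accessible`, `accessibilityGraph_adj`). An s-leaf-path likewise amounts to
two s-leaves that point at each other with `Accessible` nodes (`exists_isSLeafPath_iff`).

Every label is an induced subgraph of `G`, so it inherits a consequence of distance-heredity that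
forces prime labels to be cliques or stars (`IsSplitPrime.eq_top_or_eq_starGraph`). Hence any
non-adjacency is caused by a star, two of whose leaves point at the two vertices.

For an induced path `a b c d`, the pair `a, c` is blocked at a star `α` whose center points to `b`,
and `b, d` at a star `β` whose center points to `c`. Either `α` and `β` face each other by leaves,
which gives an s-leaf-path, or they face each other by centers, which would make `a` and `d`
adjacent (`exists_sLeaf_directions`). Conversely, beyond another leaf and the center of each end
star of an s-leaf-path lie the four vertices of an induced path (`exists_leaves_of_sLeaf`). -/

namespace SimpleGraph

/-! ### Directions in a tree. -/

section Tree

variable {V : Type u} {G : SimpleGraph V}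

/-- The second vertex of the path from `u` to `v` in a tree (`u` itself if `u = v`). -/
noncomputable def IsTree.next (h : G.IsTree) (u v : V) : V :=
  (h.existsUnique_path u v).choose.snd

variable (h : G.IsTree)
include h

theorem IsTree.next_eq_snd {u v : V} {p : G.Walk u v} (hp : p.IsPath) : h.next u v = p.snd := by
  have := (h.existsUnique_path u v).choose_spec.2 p hp
  rw [IsTree.next, this]

theorem IsTree.next_self (u : V) : h.next u u = u := by
  rw [h.next_eq_snd (p := .nil) (by simp)]; rfl

theorem IsTree.adj_next {u v : V} (huv : u ≠ v) : G.Adj u (h.next u v) := by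
  obtain ⟨p, hp, -⟩ := h.existsUnique_path u v
  rw [h.next_eq_snd hp]
  exact p.adj_snd (Walk.not_nil_of_ne huv)

theorem IsTree.next_eq_of_adj {u v : V} (huv : G.Adj u v) : h.next u v = v := by
  rw [h.next_eq_snd (p := .cons huv .nil) (by simpa using huv.ne)]; rfl

theorem IsTree.next_eq_or_next_eq {u w : V} (v : V) (huw : G.Adj u w) :
    h.next u v = w ∨ h.next w v = u := by
  obtain ⟨p, hp, -⟩ := h.existsUnique_path u v
  by_cases hw : w ∈ p.support
  · left
    rw [h.next_eq_snd hp, h.isAcyclic.eq_snd_of_adj_start hp huw hw]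
  · right
    rw [h.next_eq_snd (p := .cons huw.symm p) (by simp [Walk.cons_isPath_iff, hp, hw])]
    simp

theorem IsTree.dist_next {u v : V} (huv : u ≠ v) : G.dist u v = G.dist (h.next u v) v + 1 := by
  obtain ⟨p, hp, hl⟩ := h.connected.exists_path_of_dist u v
  cases p with
  | nil => exact absurd rfl huv
  | cons hadj q =>
    rename_i w
    have hn : h.next u v = w := by rw [h.next_eq_snd hp]; simp
    rw [hn]
    have h1 := dist_le q
    simp only [Walk.length_cons] at hl
    rcases h.dist_eq_dist_add_one_of_adj v hadj with h2 | h2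
    · simpa [dist_comm] using h2
    · rw [dist_comm, dist_comm (u := v)] at h2
      omega

theorem IsTree.next_next_ne {u v : V} (huv : u ≠ v) : h.next (h.next u v) v ≠ u := by
  intro hn
  have h1 := h.dist_next huv
  by_cases hw : h.next u v = v
  · rw [hw, h.next_self] at hn
    exact huv hn.symm
  · have h2 := h.dist_next hw
    rw [hn] at h2
    omega

theorem IsTree.next_induction {v : V} {P : V → Prop} (base : P v)
    (step : ∀ u, u ≠ v → P (h.next u v) → P u) (u : V) : P u := by
  induction hn : G.dist u v generalizing u with
  | zero =>
    rw [h.connected.dist_eq_zero_iff] at hn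
    rwa [hn]
  | succ n ih =>
    have huv : u ≠ v := by rintro rfl; simp at hn
    have := h.dist_next huv
    exact step u huv (ih _ (by omega))

/-- If `v` and `b` lie in different directions from `a`, then `v` lies in the direction of `a`
from `b`. -/
theorem IsTree.next_eq_of_next_ne {a b : V} (v : V) (hab : a ≠ b)
    (hv : h.next a v ≠ h.next a b) : h.next b v = h.next b a := by
  revert v hab
  refine h.next_induction (v := b) (P := fun a => ∀ v, a ≠ b → h.next a v ≠ h.next a b →
    h.next b v = h.next b a) (fun v h => absurd rfl h) ?_ a
  intro a hab ih v _ hv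
  have hadj := h.adj_next hab
  have h1 : h.next (h.next a b) v = a := (h.next_eq_or_next_eq v hadj).resolve_left hv
  have h2 := h.next_next_ne hab
  by_cases hc : h.next a b = b
  · rw [hc] at h1 hadj
    rw [h1, h.next_eq_of_adj hadj.symm]
  · rw [ih v hc (h1.trans_ne h2.symm), ih a hc]
    rw [h.next_eq_of_adj hadj.symm]
    exact h2.symm

/-- The edge `uw` survives the deletion of `ε`, so its ends stay in one branch. -/
theorem IsTree.next_eq_next_of_adj {u w ε : V} (huw : G.Adj u w) (hu : ε ≠ u)
    (hw : ε ≠ w) :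
    h.next ε u = h.next ε w := by
  by_cases h1 : h.next u ε = w
  · by_contra h2
    have h3 := h.next_eq_of_next_ne (a := w) (b := ε) u hw.symm
    rw [h.next_eq_of_adj huw.symm] at h3
    refine h2 (h3 ?_)
    rw [← h1]
    exact (h.next_next_ne hu.symm).symm
  · refine (h.next_eq_of_next_ne w hu.symm ?_).symm
    rw [h.next_eq_of_adj huw]
    exact Ne.symm h1

end Tree

/-! ### Prime graphs under distance-heredity. -/

section Prime

variable {V : Type u} {G : SimpleGraph V}

/-- Two nonadjacent vertices of a connected induced subgraph that have a common neighbour have one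
in this subgraph. -/
def HasInducedCommonNeighbors (G : SimpleGraph V) : Prop :=
  ∀ s : Set V, (G.induce s).Connected → ∀ x ∈ s, ∀ y ∈ s, x ≠ y → ¬ G.Adj x y →
    (∃ z, G.Adj x z ∧ G.Adj z y) → ∃ z ∈ s, G.Adj x z ∧ G.Adj z y

/-- The two vertices are at distance 2 in `G`, hence also in the subgraph. Only this case of
distance-heredity is needed, and it passes easily to induced subgraphs. -/
theorem IsDistanceHereditary.hasInducedCommonNeighbors (hG : G.IsDistanceHereditary) :
    G.HasInducedCommonNeighbors := by
  rintro s hs x hx y hy hxy hadj ⟨z, hxz, hzy⟩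
  have h1 := hG s hs ⟨x, hx⟩ ⟨y, hy⟩
  have h2 : G.dist x y ≤ 2 := dist_le (.cons hxz (.cons hzy .nil))
  obtain ⟨p, hp⟩ := hs.exists_walk_length_eq_dist ⟨x, hx⟩ ⟨y, hy⟩
  rw [h1] at hp
  match p, hp with
  | .nil, _ => exact absurd rfl hxy
  | .cons h .nil, _ => exact absurd (by simpa using h) hadj
  | .cons (v := w) h (.cons h' .nil), _ => exact ⟨w, w.2, by simpa using h, by simpa using h'⟩
  | .cons _ (.cons _ (.cons _ _)), hp => simp at hp; omega

theorem HasInducedCommonNeighbors.of_embedding {W : Type v} {H : SimpleGraph W}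
    (hG : G.HasInducedCommonNeighbors) (f : H ↪g G) : H.HasInducedCommonNeighbors := by
  rintro s hs x hx y hy hxy hadj ⟨z, hxz, hzy⟩
  have hc : (G.induce (f '' s)).Connected := by
    refine hs.map (f := ⟨fun x : s => ⟨f x, Set.mem_image_of_mem f x.2⟩, ?_⟩) ?_
    · intro a b hab
      simpa using hab
    · rintro ⟨_, a, ha, rfl⟩
      exact ⟨⟨a, ha⟩, rfl⟩
  obtain ⟨_, ⟨w, hw, rfl⟩, h1, h2⟩ := hG _ hc (f x) (Set.mem_image_of_mem f hx) (f y)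
    (Set.mem_image_of_mem f hy) (f.injective.ne hxy) (by simpa using hadj)
    ⟨f z, by simpa using hxz, by simpa using hzy⟩
  exact ⟨w, hw, by simpa using h1, by simpa using h2⟩

theorem mem_setNeighborhood {A : Set V} {x : V} :
    x ∈ G.setNeighborhood A ↔ (∃ a ∈ A, G.Adj a x) ∧ x ∉ A := by
  simp [setNeighborhood]

/-- In a prime graph with induced common neighbours, the neighbours of a vertex `d` that is not
adjacent to `r` are neighbours of `r`. -/
theorem IsSplitPrime.adj_of_not_adj (hp : G.IsSplitPrime) (hG : G.HasInducedCommonNeighbors)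
    {r d x : V} (hne : r ≠ d) (hrd : ¬ G.Adj r d) (hdx : G.Adj d x) : G.Adj r x := by
  classical
  by_contra hrx
  set S : Set V := {w | w ≠ r ∧ ¬ G.Adj r w} with hS
  have hdS : d ∈ S := ⟨hne.symm, hrd⟩
  have hxS : x ∈ S := ⟨by rintro rfl; exact hrd hdx.symm, hrx⟩
  -- `D` is the component of `d` among the non-neighbours of `r`; it contains `x` and will be one
  -- side of a split.
  set D : Set V := ⋃₀ {s | s ⊆ S ∧ d ∈ s ∧ (G.induce s).Connected}
  have hDS : D ⊆ S := Set.sUnion_subset fun s hs => hs.1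
  have hsing : ∀ v : V, (G.induce {v}).Connected := fun v => by simp
  have hd : {d} ∈ {s | s ⊆ S ∧ d ∈ s ∧ (G.induce s).Connected} :=
    ⟨by simpa using hdS, rfl, hsing d⟩
  have hdD : d ∈ D := ⟨{d}, hd, rfl⟩
  have hstep : ∀ a ∈ D, ∀ b ∈ S, G.Adj a b → b ∈ D := by
    rintro a ⟨s, ⟨hsS, hds, hs⟩, has⟩ b hb hab
    exact ⟨s ∪ {b}, ⟨Set.union_subset hsS (by simpa using hb), .inl hds,
      connected_induce_union hs.preconnected (hsing b).preconnected has rfl hab⟩, .inr rfl⟩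
  have hDconn : (G.induce D).Connected :=
    induce_sUnion_connected_of_pairwise_not_disjoint ⟨_, hd⟩
      (fun hs ht => ⟨d, hs.2.1, ht.2.1⟩) fun hs => hs.2.2
  have hrD : r ∉ D := fun hr => (hDS hr).1 rfl
  refine hp.2 D ⟨⟨d, hdD, x, hstep d hdD x hxS hdx, hdx.ne⟩, ?_, ?_⟩
  · obtain ⟨w, hw⟩ : ∃ w, G.Adj r w := by
      obtain ⟨p⟩ := hp.1.preconnected r d
      cases p with
      | nil => exact absurd rfl hne
      | cons hadj _ => exact ⟨_, hadj⟩
    exact ⟨r, hrD, w, fun hwD => (hDS hwD).2 hw, hw.ne⟩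
  · intro z hz y hy
    rw [mem_setNeighborhood] at hz hy
    obtain ⟨⟨a, haD, haz⟩, hzD⟩ := hz
    obtain ⟨⟨b, hbD, hby⟩, hyD⟩ := hy
    rw [Set.notMem_compl_iff] at hyD
    have hout : ∀ a ∈ D, ∀ z ∉ D, G.Adj a z → G.Adj r z := by
      intro a ha z hz haz
      by_contra hrz
      refine hz (hstep a ha z ⟨?_, hrz⟩ haz)
      rintro rfl
      exact (hDS ha).2 haz.symm
    have hrz := hout a haD z hzD haz
    have hrb := hout y hyD b hbD hby.symm
    -- In this connected set `z` is the only neighbour of `r`, so the common neighbour of `r` and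
    -- `y` found there must be `z`.
    have hc : (G.induce ((D ∪ {z}) ∪ {r})).Connected :=
      connected_induce_union
        (connected_induce_union hDconn.preconnected (hsing z).preconnected haD rfl haz).preconnected
        (hsing r).preconnected (.inr rfl) rfl hrz.symm
    obtain ⟨w, hw, h1, h2⟩ := hG _ hc r (by simp) y (by simp [hyD]) (hDS hyD).1.symm (hDS hyD).2
      ⟨b, hrb, hby⟩
    rcases hw with (hw | rfl) | rfl
    · exact absurd h1 (hDS hw).2
    · exact h2
    · exact absurd rfl h1.ne

/-- Non-adjacent vertices `r`, `d` have the same neighbours, so `{r, d}` would be a split if there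
were two further vertices. What remains is a star with two leaves. -/
theorem IsSplitPrime.eq_top_or_eq_starGraph (hp : G.IsSplitPrime)
    (hG : G.HasInducedCommonNeighbors) :
    G = ⊤ ∨ ∃ c, G = starGraph c := by
  classical
  by_cases htop : G = ⊤
  · exact .inl htop
  right
  obtain ⟨r, d, hne, hrd⟩ : ∃ r d, r ≠ d ∧ ¬ G.Adj r d := by
    by_contra! hcon
    exact htop (eq_top_iff.2 fun a b hab => hcon a b hab)
  have htwin : ∀ x, G.Adj r x ↔ G.Adj d x := fun x =>
    ⟨fun hx => hp.adj_of_not_adj hG hne.symm (fun h => hrd h.symm) hx,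
      fun hx => hp.adj_of_not_adj hG hne hrd hx⟩
  obtain ⟨c, hrc⟩ : ∃ c, G.Adj r c := by
    obtain ⟨p⟩ := hp.1.preconnected r d
    cases p with
    | nil => exact absurd rfl hne
    | cons hadj _ => exact ⟨_, hadj⟩
  have hdc := (htwin c).1 hrc
  by_cases hex : ∀ w, w = r ∨ w = d ∨ w = c
  · refine ⟨c, ?_⟩
    ext a b
    have hdr : ¬ G.Adj d r := fun h => hrd h.symm
    have := hrc.symm; have := hdc.symm; have := hrc.ne; have := hdc.ne
    rcases hex a with rfl | rfl | rfl <;> rcases hex b with rfl | rfl | rfl <;>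
      simp_all [starGraph_adj] <;> grind
  · push Not at hex
    obtain ⟨w, hwr, hwd, hwc⟩ := hex
    refine absurd ?_ (hp.2 {r, d})
    refine ⟨⟨r, by simp, d, by simp, hne⟩, ⟨w, by simp [hwr, hwd], c, ?_, hwc⟩, ?_⟩
    · simp [hrc.ne', hdc.ne']
    · intro x hx y hy
      rw [mem_setNeighborhood] at hx hy
      obtain ⟨⟨a, ha, hax⟩, -⟩ := hx
      have hy := Set.notMem_compl_iff.1 hy.2
      rcases ha with rfl | rfl <;> rcases hy with rfl | rfl
      · exact hax.symm
      · exact ((htwin x).1 hax).symm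
      · exact ((htwin x).2 hax).symm
      · exact hax.symm

end Prime

end SimpleGraph

/-! ### Alternated paths as conditions on tree nodes. -/

namespace GraphLabelledTree

open SimpleGraph

variable {N : Type v} (T : GraphLabelledTree N)

/-- The neighbour of the node `u` in the direction of the node `v`. -/
noncomputable abbrev next (u v : N) : N := T.isTree.next u v

/-- Adjacency in the label of the node `ε`, as a relation on nodes. -/
def LabelAdj (ε p q : N) : Prop :=
  ∃ (hp : T.tree.Adj ε p) (hq : T.tree.Adj ε q), (T.label ε).Adj ⟨p, hp⟩ ⟨q, hq⟩

/-- The nodes strictly between `u` and `v` can be traversed by an alternated path. -/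
def Accessible (u v : N) : Prop :=
  ∀ ε, ε ≠ u → ε ≠ v → T.next ε u ≠ T.next ε v → T.LabelAdj ε (T.next ε u) (T.next ε v)

variable {T}

theorem LabelAdj.symm {ε p q : N} (h : T.LabelAdj ε p q) : T.LabelAdj ε q p :=
  let ⟨hp, hq, h⟩ := h; ⟨hq, hp, h.symm⟩

theorem LabelAdj.ne {ε p q : N} (h : T.LabelAdj ε p q) : p ≠ q := by
  rintro rfl
  exact h.2.2.ne rfl

theorem Accessible.symm {u v : N} (h : T.Accessible u v) : T.Accessible v u :=
  fun ε hv hu hne => (h ε hu hv hne.symm).symm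

theorem component_adj {α : N} {x y : T.Vertex} :
    (T.component α).Adj x y ↔ x.fst = α ∧ y.fst = α ∧ T.LabelAdj α x.snd y.snd := by
  rw [component, SimpleGraph.map_adj']
  constructor
  · rintro ⟨-, ⟨a, ha⟩, ⟨b, hb⟩, hab, rfl, rfl⟩
    exact ⟨rfl, rfl, ha, hb, hab⟩
  · obtain ⟨⟨x1, x2⟩, hx⟩ := x
    obtain ⟨⟨y1, y2⟩, hy⟩ := y
    rintro ⟨h1, h2, ha, hb, hab⟩
    simp only at h1 h2
    subst h1 h2
    refine ⟨fun h => hab.ne (Subtype.ext (congrArg (fun x : T.Vertex => x.snd) h)),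
      ⟨x2, ha⟩, ⟨y2, hb⟩, hab, rfl, rfl⟩

theorem fGraph_adj {x y : T.Vertex} :
    T.fGraph.Adj x y ↔ x.fst = y.fst ∧ T.LabelAdj x.fst x.snd y.snd := by
  simp only [fGraph, SimpleGraph.iSup_adj, component_adj]
  constructor
  · rintro ⟨α, rfl, h2, h3⟩
    exact ⟨h2.symm, h3⟩
  · rintro ⟨h1, h2⟩
    exact ⟨x.fst, rfl, h1.symm, h2⟩

theorem not_fGraph_adj_symm (x : T.Vertex) : ¬ T.fGraph.Adj x x.symm := by
  rw [fGraph_adj]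
  exact fun h => x.adj.ne h.1

theorem vertex_ext {x y : T.Vertex} (h1 : x.fst = y.fst) (h2 : x.snd = y.snd) : x = y :=
  Dart.ext _ _ (Prod.ext h1 h2)

theorem Accessible.of_adj {u v : N} (h : T.tree.Adj u v) : T.Accessible u v :=
  fun _ hu hv hne => absurd (T.isTree.next_eq_next_of_adj h hu hv) hne

theorem Accessible.of_next {u v : N} (huv : u ≠ v) (h : T.Accessible u v) :
    T.Accessible (T.next u v) v := by
  intro ε h1 h2 hne
  have hadj := T.isTree.adj_next huv
  by_cases hu : ε = u
  · subst hu
    exact absurd (T.isTree.next_eq_of_adj hadj) hne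
  · have := T.isTree.next_eq_next_of_adj hadj hu h1
    rw [next, next, ← this] at hne ⊢
    exact h ε hu h2 hne

theorem next_next {u v : N} (huv : u ≠ v) (hw : T.next u v ≠ v) :
    T.next v (T.next u v) = T.next v u :=
  T.isTree.next_eq_next_of_adj (T.isTree.adj_next huv) huv.symm hw.symm |>.symm

/-- The alternated path that connects the outer ends of an accessible pair of nodes. -/
theorem Accessible.exists_walk {u v : N} (hacc : T.Accessible u v) (huv : u ≠ v)
    (x y : T.Vertex) (hxu : x.fst = u) (hx : x.snd = T.next u v)
    (hyv : y.fst = v) (hy : y.snd = T.next v u) :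
    ∃ p : T.graph.Walk x y, T.IsAlternatedPath p ∧
      (∀ e ∈ p.edges.head?, e ∈ T.tGraph.edgeSet) ∧
      (∀ z ∈ p.support, T.tree.dist z.fst v ≤ T.tree.dist u v ∧ (z.fst = u → z = x) ∧
        (z.fst = v → z = y)) := by
  revert x hacc
  -- The distance bound keeps the later part of the path away from `u`. The two end clauses say that
  -- each end component is met in one vertex only, so none of its edges is used.
  refine T.isTree.next_induction (v := v)
    (P := fun u => u ≠ v → y.snd = T.next v u → T.Accessible u v → ∀ x : T.Vertex, x.fst = u →
      x.snd = T.next u v →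
      ∃ p : T.graph.Walk x y, T.IsAlternatedPath p ∧
        (∀ e ∈ p.edges.head?, e ∈ T.tGraph.edgeSet) ∧
        (∀ z ∈ p.support, T.tree.dist z.fst v ≤ T.tree.dist u v ∧ (z.fst = u → z = x) ∧
          (z.fst = v → z = y))) (fun h => absurd rfl h) ?_ u huv hy
  clear huv hy u
  intro u huv ih _ hy hacc x hxu hx
  have hT : T.tGraph.Adj x x.symm := rfl
  have hG : T.graph.Adj x x.symm := .inl hT
  have hdist : T.tree.dist u v = T.tree.dist (T.next u v) v + 1 := T.isTree.dist_next huv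
  by_cases hw : T.next u v = v
  · have hyx : y = x.symm := by
      refine vertex_ext (hyv.trans (hw.symm.trans hx.symm)) ?_
      rw [hy]
      refine (T.isTree.next_eq_of_adj ?_).trans hxu.symm
      rw [← hw]
      exact (T.isTree.adj_next huv).symm
    subst hyx
    refine ⟨.cons hG .nil, ⟨?_, ?_⟩, ?_, ?_⟩
    · simpa using hG.ne
    · simp
    · simpa using hT
    · have hs : x.symm.fst = v := hyv
      intro z hz
      simp only [Walk.support_cons, Walk.support_nil, List.mem_cons, List.not_mem_nil,
        or_false] at hz
      rcases hz with rfl | rfl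
      · exact ⟨by rw [hxu], fun _ => rfl, fun h => absurd (hxu.symm.trans h) huv⟩
      · refine ⟨by rw [hs]; simp, fun h => absurd (h.symm.trans hs) huv, fun _ => rfl⟩
  · let z : T.Vertex := ⟨(T.next u v, T.next (T.next u v) v), T.isTree.adj_next hw⟩
    obtain ⟨p, ⟨hpath, hchain⟩, hhead, hsupp⟩ :=
      ih hw (hy.trans (next_next huv hw).symm) (hacc.of_next huv) z rfl rfl
    have hFz : T.fGraph.Adj x.symm z := by
      rw [fGraph_adj]
      refine ⟨hx, ?_⟩
      have hu : u ≠ T.next u v := (T.isTree.adj_next huv).ne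
      have h1 : T.next (T.next u v) u = u :=
        T.isTree.next_eq_of_adj (T.isTree.adj_next huv).symm
      have h2 := hacc (T.next u v) hu.symm hw
        (h1.trans_ne (T.isTree.next_next_ne huv).symm)
      rw [h1] at h2
      change T.LabelAdj x.snd x.fst _
      rw [hx, hxu]
      exact h2
    have hGz : T.graph.Adj x.symm z := .inr hFz
    have hne1 : ∀ z' ∈ p.support, z'.fst ≠ u := by
      intro z' hz' h
      have : T.tree.dist z'.fst v ≤ T.tree.dist (T.next u v) v := (hsupp z' hz').1
      rw [h] at this
      omega
    have hne2 : x.symm ∉ p.support := fun h =>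
      hFz.ne ((hsupp _ h).2.1 hx)
    refine ⟨.cons hG (.cons hGz p), ⟨?_, ?_⟩, ?_, ?_⟩
    · rw [Walk.cons_isPath_iff, Walk.cons_isPath_iff]
      refine ⟨⟨hpath, hne2⟩, ?_⟩
      simp only [Walk.support_cons, List.mem_cons, not_or]
      exact ⟨hG.ne, fun h => hne1 _ h hxu⟩
    · simp only [Walk.edges_cons]
      refine .cons_cons (.inl ⟨hT, hFz⟩) ?_
      rw [List.isChain_cons]
      exact ⟨fun e he => .inr ⟨hFz, hhead e he⟩, hchain⟩
    · simpa using hT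
    · intro z' hz'
      simp only [Walk.support_cons, List.mem_cons] at hz'
      rcases hz' with rfl | rfl | hz'
      · exact ⟨by rw [hxu], fun _ => rfl, fun h => absurd (hxu.symm.trans h) huv⟩
      · have hs : x.symm.fst = T.next u v := hx
        refine ⟨by rw [hs]; omega, fun h => absurd (h.symm.trans hs) ?_,
          fun h => absurd (hs.symm.trans h) hw⟩
        exact (T.isTree.adj_next huv).ne
      · refine ⟨?_, fun h => absurd h (hne1 _ hz'), (hsupp z' hz').2.2⟩
        have : T.tree.dist z'.fst v ≤ T.tree.dist (T.next u v) v := (hsupp z' hz').1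
        omega

theorem head_mem_edgeSet_tGraph {x y : T.Vertex} (p : T.graph.Walk x y)
    (hx : ∀ e ∈ p.edges, x ∈ e → e ∉ T.fGraph.edgeSet) :
    ∀ e ∈ p.edges.head?, e ∈ T.tGraph.edgeSet := by
  intro e he
  cases p with
  | nil => simp at he
  | cons h q =>
    simp only [Walk.edges_cons, List.head?_cons, Option.mem_def, Option.some.injEq] at he
    subst he
    exact h.resolve_right (hx _ (by simp) (Sym2.mem_mk_left _ _))

/-- An `F`-edge changes the tree edge, so the next `T`-edge cannot go back: the walk projects to the
tree path. The recursion removes a `T`-edge and an `F`-edge at a time. -/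
theorem accessible_of_walk {x y : T.Vertex} (p : T.graph.Walk x y)
    (hchain : p.edges.IsChain fun e f =>
      (e ∈ T.tGraph.edgeSet ∧ f ∈ T.fGraph.edgeSet) ∨
      (e ∈ T.fGraph.edgeSet ∧ f ∈ T.tGraph.edgeSet))
    (hx : ∀ e ∈ p.edges.head?, e ∈ T.tGraph.edgeSet)
    (hy : ∀ e ∈ p.edges, y ∈ e → e ∉ T.fGraph.edgeSet) (hxy : x ≠ y) :
    x.fst ≠ y.fst ∧ x.snd = T.next x.fst y.fst ∧ y.snd = T.next y.fst x.fst ∧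
      T.Accessible x.fst y.fst := by
  match p, hchain, hx, hy with
  | .nil, _, _, _ => exact absurd rfl hxy
  | .cons h .nil, _, hx, _ =>
    have h1 : y = x.symm := hx s(x, y) (by simp)
    subst h1
    exact ⟨x.adj.ne, (T.isTree.next_eq_of_adj x.adj).symm,
      (T.isTree.next_eq_of_adj x.adj.symm).symm, .of_adj x.adj⟩
  | .cons (v := w) h (.cons (v := z) h' q), hchain, hx, hy =>
    have h1 : w = x.symm := hx s(x, w) (by simp)
    subst h1
    simp only [Walk.edges_cons] at hchain hy
    obtain ⟨hc1, hc2⟩ := List.isChain_cons_cons.1 hchain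
    have hFz : T.fGraph.Adj x.symm z := by
      rcases hc1 with hc1 | hc1
      · exact hc1.2
      · exact absurd hc1.1 (not_fGraph_adj_symm x)
    have hFz' := fGraph_adj.1 hFz
    rw [List.isChain_cons] at hc2
    have hzy : z ≠ y := by
      rintro rfl
      exact hy s(x.symm, z) (by simp) (by simp) hFz
    obtain ⟨hne, h2, h3, hacc⟩ := accessible_of_walk q hc2.2
      (fun e he => by
        rcases hc2.1 e he with h | h
        · have hz : z = x.symm.symm := h.1
          rw [hz] at hFz
          exact absurd hFz (not_fGraph_adj_symm _)
        · exact h.2)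
      (fun e he => hy e (by simp [he])) hzy
    obtain ⟨hf, hl⟩ := hFz'
    have hf' : z.fst = x.snd := hf.symm
    have hl' : T.LabelAdj x.snd x.fst z.snd := hl
    rw [hf'] at hne h2 h3 hacc
    -- No backtracking: the rest of the walk leaves `x.snd` through `z.snd`, which differs from
    -- `x.fst`.
    have hn : T.next x.snd y.fst ≠ x.fst := h2 ▸ hl'.ne.symm
    have hxs : T.next x.fst y.fst = x.snd :=
      (T.isTree.next_eq_or_next_eq y.fst x.adj).resolve_right hn
    have hxy' : x.fst ≠ y.fst := by
      intro h
      rw [← h] at hn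
      exact hn (T.isTree.next_eq_of_adj x.adj.symm)
    refine ⟨hxy', hxs.symm, ?_, ?_⟩
    · rw [h3]
      exact (T.isTree.next_eq_next_of_adj x.adj hxy'.symm hne.symm).symm
    · intro ε he1 he2 hee
      by_cases hex : ε = x.snd
      · subst hex
        have : T.next x.snd x.fst = x.fst := T.isTree.next_eq_of_adj x.adj.symm
        rw [this, ← h2]
        exact hl'
      · have := T.isTree.next_eq_next_of_adj x.adj he1 hex
        rw [next, next, this] at hee ⊢
        exact hacc ε hex he2 hee

theorem LabelAdj.isInternalNode [Finite N] {ε p q : N} (h : T.LabelAdj ε p q) :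
    T.IsInternalNode ε := by
  obtain ⟨hp, hq, -⟩ := id h
  have : 1 < (T.tree.neighborSet ε).ncard :=
    (Set.one_lt_ncard_iff (Set.toFinite _)).2 ⟨p, q, hp, hq, h.ne⟩
  exact this

theorem IsLeafNode.not_isInternalNode {a : N} (h : T.IsLeafNode a) : ¬ T.IsInternalNode a := by
  unfold IsInternalNode IsLeafNode at *
  omega

theorem IsLeafNode.eq_of_adj {a p q : N} (h : T.IsLeafNode a) (hp : T.tree.Adj a p)
    (hq : T.tree.Adj a q) : p = q := by
  obtain ⟨c, hc⟩ := Set.ncard_eq_one.1 h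
  have h1 : p ∈ T.tree.neighborSet a := hp
  have h2 : q ∈ T.tree.neighborSet a := hq
  rw [hc] at h1 h2
  exact Eq.trans h1 (Eq.symm h2)

/-- A tree leaf has only one direction: it meets no `F`-edge, and its vertex points towards every
other node. -/
theorem accessibilityGraph_adj [Finite N] {a b : {x : T.Vertex // T.IsLeafNode x.fst}} :
    T.accessibilityGraph.Adj a b ↔ a.1.fst ≠ b.1.fst ∧ T.Accessible a.1.fst b.1.fst := by
  have hleaf : ∀ (a : {x : T.Vertex // T.IsLeafNode x.fst}) (e : Sym2 T.Vertex), a.1 ∈ e →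
      e ∉ T.fGraph.edgeSet := by
    rintro ⟨a, ha⟩ e hae he
    obtain ⟨b, rfl⟩ := hae
    exact ha.not_isInternalNode (fGraph_adj.1 he).2.isInternalNode
  constructor
  · rintro ⟨hne, p, hp, hchain⟩
    obtain ⟨h1, -, -, h2⟩ := accessible_of_walk p hchain
      (head_mem_edgeSet_tGraph p fun e _ h => hleaf a e h) (fun e _ h => hleaf b e h)
      (fun h => hne (Subtype.ext h))
    exact ⟨h1, h2⟩
  · rintro ⟨hne, hacc⟩
    obtain ⟨p, hp, -, -⟩ := hacc.exists_walk hne a.1 b.1 rfl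
      (a.2.eq_of_adj a.1.adj (T.isTree.adj_next hne)) rfl
      (b.2.eq_of_adj b.1.adj (T.isTree.adj_next hne.symm))
    exact ⟨fun h => hne (by rw [h]), p, hp⟩

/-- Avoiding the edges of both end components forces the path to start and end with `T`-edges. -/
theorem exists_isSLeafPath_iff {x y : T.Vertex} :
    (∃ p : T.graph.Walk x y, T.IsSLeafPath p) ↔ T.IsSLeaf x ∧ T.IsSLeaf y ∧ x.fst ≠ y.fst ∧
      x.snd = T.next x.fst y.fst ∧ y.snd = T.next y.fst x.fst ∧ T.Accessible x.fst y.fst := by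
  constructor
  · rintro ⟨p, ⟨-, hchain⟩, hx, hy, hne, hedges⟩
    refine ⟨hx, hy, hne, (accessible_of_walk p hchain (head_mem_edgeSet_tGraph p ?_) ?_
      fun h => hne (by rw [h])).2⟩
    · rintro e he ⟨z, rfl⟩ hF
      have hF := fGraph_adj.1 hF
      exact (hedges _ he).1 (component_adj.2 ⟨rfl, hF.1.symm, hF.2⟩)
    · rintro e he ⟨z, rfl⟩ hF
      have hF := fGraph_adj.1 hF
      exact (hedges _ he).2 (component_adj.2 ⟨rfl, hF.1.symm, hF.2⟩)
  · rintro ⟨hx, hy, hne, h1, h2, hacc⟩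
    obtain ⟨p, hp, -, hsupp⟩ := hacc.exists_walk hne x y rfl h1 rfl h2
    refine ⟨p, hp, hx, hy, hne, fun e he => ?_⟩
    induction e with
    | _ a b =>
      have ha := hsupp a (p.fst_mem_support_of_mem_edges he)
      have hb := hsupp b (p.snd_mem_support_of_mem_edges he)
      constructor <;> intro h <;> rw [mem_edgeSet] at h <;> refine h.ne ?_ <;>
        rw [component_adj] at h
      · exact (ha.2.1 h.1).trans (hb.2.1 h.2.1).symm
      · exact (ha.2.2 h.1).trans (hb.2.2 h.2.1).symm

end GraphLabelledTree

/-! ### Induced paths on four vertices. -/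

namespace SimpleGraph

theorem pathGraph_four_isIndContained_iff {V : Type u} {G : SimpleGraph V} :
    (pathGraph 4).IsIndContained G ↔ ∃ a b c d, G.Adj a b ∧ G.Adj b c ∧ G.Adj c d ∧
      ¬ G.Adj a c ∧ ¬ G.Adj b d ∧ ¬ G.Adj a d := by
  constructor
  · rintro ⟨f⟩
    refine ⟨f 0, f 1, f 2, f 3, ?_⟩
    simp only [f.map_adj_iff, pathGraph_adj]
    decide
  · rintro ⟨a, b, c, d, hab, hbc, hcd, hac, hbd, had⟩
    have h1 : a ≠ c := by rintro rfl; exact had hcd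
    have h2 : b ≠ d := by rintro rfl; exact had hab
    have h3 : a ≠ d := by rintro rfl; exact hac hcd.symm
    have hab' := hab.ne; have hbc' := hbc.ne; have hcd' := hcd.ne
    refine ⟨⟨⟨![a, b, c, d], ?_⟩, ?_⟩⟩
    · intro i j hij
      fin_cases i <;> fin_cases j <;> simp_all
    · intro i j
      change G.Adj (![a, b, c, d] i) (![a, b, c, d] j) ↔ _
      have := fun h => hac (Adj.symm h)
      have := fun h => hbd (Adj.symm h)
      have := fun h => had (Adj.symm h)
      have := hab.symm; have := hbc.symm; have := hcd.symm
      fin_cases i <;> fin_cases j <;> simp_all [pathGraph_adj]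

theorem Connected.exists_adj {V : Type u} {G : SimpleGraph V} (hG : G.Connected) {a b : V}
    (hab : a ≠ b) : ∃ c, G.Adj a c := by
  obtain ⟨p⟩ := hG.preconnected a b
  cases p with
  | nil => exact absurd rfl hab
  | cons hadj _ => exact ⟨_, hadj⟩

end SimpleGraph

/-! ### Accessibility through a node, and labels as induced subgraphs. -/

namespace GraphLabelledTree

open SimpleGraph

variable {N : Type v} {T : GraphLabelledTree N}

theorem labelAdj_iff_of_label_eq_starGraph {ε z : N} {hz : T.tree.Adj ε z}
    (h : T.label ε = starGraph ⟨z, hz⟩) {p q : N} (hp : T.tree.Adj ε p) (hq : T.tree.Adj ε q) :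
    T.LabelAdj ε p q ↔ p ≠ q ∧ (p = z ∨ q = z) := by
  simp [LabelAdj, h, hp, hq, starGraph_adj, Subtype.ext_iff]

theorem next_eq_or {a b : N} (hab : a ≠ b) (v : N) :
    T.next a v = T.next a b ∨ T.next b v = T.next b a :=
  or_iff_not_imp_left.2 (T.isTree.next_eq_of_next_ne v hab)

theorem isInternalNode_of_adj_of_adj [Finite N] {ε p q : N} (hp : T.tree.Adj ε p)
    (hq : T.tree.Adj ε q) (hpq : p ≠ q) : T.IsInternalNode ε :=
  (Set.one_lt_ncard_iff (Set.toFinite _)).2 ⟨p, q, hp, hq, hpq⟩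

/-- Since `α` separates `a` from `b`, the two given connections are concatenated at `α`, where the
only new condition arises. -/
theorem accessible_iff_labelAdj {α a b : N} (ha : α ≠ a) (hb : α ≠ b)
    (hne : T.next α a ≠ T.next α b) (hacca : T.Accessible α a) (haccb : T.Accessible α b) :
    T.Accessible a b ↔ T.LabelAdj α (T.next α a) (T.next α b) := by
  refine ⟨fun h => h α ha hb hne, fun h ε hea heb hee => ?_⟩
  by_cases hα : ε = α
  · rwa [hα]
  · have h1 := T.next_eq_or (Ne.symm hα) a
    have h2 := T.next_eq_or (Ne.symm hα) b
    by_cases h3 : T.next ε a = T.next ε α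
    · rw [h3] at hee ⊢
      exact haccb ε hα heb hee
    · have h4 : T.next ε b = T.next ε α :=
        h2.resolve_left fun h => hne ((h1.resolve_right h3).trans h.symm)
      rw [h4] at hee ⊢
      exact (hacca ε hα hea hee.symm).symm

/-- A farthest accessible node beyond `w` is a leaf: at an internal node, connectedness of the label
would allow one more step outwards. -/
theorem exists_isLeafNode_accessible [Finite N]
    (hT : ∀ ε, T.IsInternalNode ε → (T.label ε).Connected) {α w : N} (hw : T.tree.Adj α w) :
    ∃ v, T.IsLeafNode v ∧ α ≠ v ∧ T.next α v = w ∧ T.Accessible α v := by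
  obtain ⟨v, ⟨hαv, hnext, hacc⟩, hmax⟩ := Set.exists_max_image
    {v | α ≠ v ∧ T.next α v = w ∧ T.Accessible α v} (fun v => T.tree.dist v α) (Set.toFinite _)
    ⟨w, hw.ne, T.isTree.next_eq_of_adj hw, .of_adj hw⟩
  refine ⟨v, ?_, hαv, hnext, hacc⟩
  by_contra hleaf
  have hadj : T.tree.Adj v (T.next v α) := T.isTree.adj_next hαv.symm
  have hpos : 0 < (T.tree.neighborSet v).ncard :=
    (Set.ncard_pos (Set.toFinite _)).2 ⟨_, hadj⟩
  have hint : T.IsInternalNode v := by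
    unfold IsLeafNode at hleaf
    unfold IsInternalNode
    omega
  obtain ⟨q, hq, hqne⟩ := Set.exists_ne_of_one_lt_ncard hint (T.next v α)
  obtain ⟨⟨r, hvr : T.tree.Adj v r⟩, hr⟩ := (hT v hint).exists_adj
    (a := ⟨_, hadj⟩) (b := ⟨q, hq⟩) (fun h => hqne (congrArg Subtype.val h).symm)
  have hr : T.LabelAdj v (T.next v α) r := ⟨_, _, hr⟩
  have hnr : T.next v r = r := T.isTree.next_eq_of_adj hvr
  have hrα : r ≠ α := by
    rintro rfl
    exact hr.ne hnr
  have h1 : T.next r α = v := (T.isTree.next_eq_or_next_eq α hvr).resolve_left hr.ne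
  have h2 : T.tree.dist r α = T.tree.dist (T.next r α) α + 1 := T.isTree.dist_next hrα
  have hne : T.next v α ≠ T.next v r := hnr.symm ▸ hr.ne
  have h3 := hmax r ⟨hrα.symm, ?_, ?_⟩
  · simp only [h2, h1] at h3
    omega
  · exact ((T.next_eq_or hαv.symm r).resolve_left hne.symm).trans hnext
  · rw [accessible_iff_labelAdj hαv.symm hvr.ne hne hacc.symm (.of_adj hvr), hnr]
    exact hr

/-- Every label embeds as an induced subgraph into the accessibility graph. -/
theorem label_isIndContained_accessibilityGraph [Finite N]
    (hT : ∀ ε, T.IsInternalNode ε → (T.label ε).Connected) (α : N) :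
    (T.label α).IsIndContained T.accessibilityGraph := by
  -- Each label vertex is represented by an accessible leaf in its direction.
  choose f hf using fun q : T.tree.neighborSet α => exists_isLeafNode_accessible hT q.2
  have key : ∀ p q, p ≠ q → (T.Accessible (f p) (f q) ↔ (T.label α).Adj p q) := by
    intro p q hpq
    have hne : T.next α (f p) ≠ T.next α (f q) := by
      rw [(hf p).2.2.1, (hf q).2.2.1]
      exact fun h => hpq (Subtype.ext h)
    rw [accessible_iff_labelAdj (hf p).2.1 (hf q).2.1 hne (hf p).2.2.2 (hf q).2.2.2,
      (hf p).2.2.1, (hf q).2.2.1]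
    exact ⟨fun ⟨_, _, h⟩ => h, fun h => ⟨_, _, h⟩⟩
  have hinj : Function.Injective f := by
    intro p q hpq
    refine Subtype.ext ?_
    rw [← (hf p).2.2.1, hpq, (hf q).2.2.1]
  refine ⟨⟨⟨fun q => ⟨⟨(f q, T.next (f q) α), T.isTree.adj_next (hf q).2.1.symm⟩, (hf q).1⟩,
    fun p q hpq => hinj ?_⟩, ?_⟩⟩
  · exact congrArg (fun x : {x : T.Vertex // T.IsLeafNode x.fst} => x.1.fst) hpq
  · intro p q
    rw [accessibilityGraph_adj]
    change f p ≠ f q ∧ T.Accessible (f p) (f q) ↔ _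
    by_cases hpq : p = q
    · simp [hpq]
    · simp [key p q hpq, hinj.ne hpq]

/-! ### Induced paths and facing s-leaves. -/

namespace IsMinimalSplitDecompositionTree

variable {V : Type u} {G : SimpleGraph V} (hT : T.IsMinimalSplitDecompositionTree G)
include hT

theorem label_connected [Finite N] {α : N} (hα : T.IsInternalNode α) :
    (T.label α).Connected := by
  have : Nonempty (T.tree.neighborSet α) := by
    obtain ⟨a, ha⟩ := (Set.ncard_pos (Set.toFinite (T.tree.neighborSet α))).1
      (lt_of_lt_of_le two_pos hα)
    exact ⟨a, ha⟩
  rcases hT.clique_or_star_or_prime α hα with h | ⟨c, h⟩ | h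
  · rw [h]
    exact connected_top
  · rw [h]
    exact connected_starGraph c
  · exact h.1

theorem clique_or_star [Finite N] (hG : G.IsDistanceHereditary) {α : N}
    (hα : T.IsInternalNode α) : T.label α = ⊤ ∨ ∃ c, T.label α = starGraph c := by
  rcases hT.clique_or_star_or_prime α hα with h | h | h
  · exact .inl h
  · exact .inr h
  · obtain ⟨f⟩ := label_isIndContained_accessibilityGraph (fun ε hε => hT.label_connected hε) α
    obtain ⟨e⟩ := hT.accessibility_iso
    exact h.eq_top_or_eq_starGraph
      (hG.hasInducedCommonNeighbors.of_embedding (f.trans e.toEmbedding))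

/-- A node at which two directions are not adjacent carries a star. -/
theorem exists_label_eq_starGraph [Finite N] (hG : G.IsDistanceHereditary) {α p q : N}
    (hp : T.tree.Adj α p) (hq : T.tree.Adj α q) (hpq : p ≠ q) (hadj : ¬ T.LabelAdj α p q) :
    ∃ z, ∃ hz : T.tree.Adj α z, T.label α = starGraph ⟨z, hz⟩ := by
  rcases hT.clique_or_star hG (isInternalNode_of_adj_of_adj hp hq hpq) with h | ⟨⟨z, hz⟩, h⟩
  · refine absurd ⟨hp, hq, ?_⟩ hadj
    rw [h, top_adj]
    exact fun h => hpq (congrArg Subtype.val h)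
  · exact ⟨z, hz, h⟩

/-- The nodes `α` and `β` are stars blocking `a, c` and `b, d`. -/
theorem exists_sLeaf_directions [Finite N] (hG : G.IsDistanceHereditary) {a b c d : N}
    (ha : T.IsLeafNode a) (hb : T.IsLeafNode b) (hc : T.IsLeafNode c) (hd : T.IsLeafNode d)
    (hab : T.Accessible a b) (hbc : T.Accessible b c) (hcd : T.Accessible c d)
    (hac : ¬ T.Accessible a c) (hbd : ¬ T.Accessible b d) (had : ¬ T.Accessible a d) :
    ∃ α β, α ≠ β ∧ T.Accessible α β ∧
      (∃ z, ∃ hz : T.tree.Adj α z, T.label α = starGraph ⟨z, hz⟩ ∧ T.next α β ≠ z) ∧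
      (∃ z, ∃ hz : T.tree.Adj β z, T.label β = starGraph ⟨z, hz⟩ ∧ T.next β α ≠ z) := by
  have hleaf : ∀ {ε l : N}, T.IsInternalNode ε → T.IsLeafNode l → ε ≠ l := by
    rintro ε l hε hl rfl
    exact hl.not_isInternalNode hε
  have hsep : ∀ {u v : N}, ¬ T.Accessible u v → ∃ ε, T.IsInternalNode ε ∧
      T.next ε u ≠ T.next ε v ∧ ¬ T.LabelAdj ε (T.next ε u) (T.next ε v) ∧
      ∃ z, ∃ hz : T.tree.Adj ε z, T.label ε = starGraph ⟨z, hz⟩ := by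
    intro u v huv
    simp only [Accessible, not_forall] at huv
    obtain ⟨ε, hu, hv, hne, hadj⟩ := huv
    have h1 := T.isTree.adj_next hu
    have h2 := T.isTree.adj_next hv
    exact ⟨ε, isInternalNode_of_adj_of_adj h1 h2 hne, hne, hadj,
      hT.exists_label_eq_starGraph hG h1 h2 hne hadj⟩
  have hacc : ∀ {ε u v : N}, T.IsInternalNode ε → T.IsLeafNode u → T.IsLeafNode v →
      T.Accessible u v →
      T.next ε u = T.next ε v ∨ T.LabelAdj ε (T.next ε u) (T.next ε v) :=
    fun hε hu hv huv =>
      or_iff_not_imp_left.2 fun hne => huv _ (hleaf hε hu) (hleaf hε hv) hne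
  obtain ⟨α, hα, hα1, hα2, z, hz, hαz⟩ := hsep hac
  obtain ⟨β, hβ, hβ1, hβ2, z', hz', hβz⟩ := hsep hbd
  have star : ∀ {ε z u v : N} (hz : T.tree.Adj ε z), T.label ε = starGraph ⟨z, hz⟩ →
      T.IsInternalNode ε → T.IsLeafNode u → T.IsLeafNode v →
      (T.LabelAdj ε (T.next ε u) (T.next ε v) ↔
        T.next ε u ≠ T.next ε v ∧ (T.next ε u = z ∨ T.next ε v = z)) :=
    fun hz hεz hε hu hv => labelAdj_iff_of_label_eq_starGraph hεz
      (T.isTree.adj_next (hleaf hε hu)) (T.isTree.adj_next (hleaf hε hv))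
  have hαab := hacc hα ha hb hab
  have hαbc := hacc hα hb hc hbc
  have hαcd := hacc hα hc hd hcd
  have hβab := hacc hβ ha hb hab
  have hβbc := hacc hβ hb hc hbc
  have hβcd := hacc hβ hc hd hcd
  rw [star hz hαz hα ha hb] at hαab
  rw [star hz hαz hα hb hc] at hαbc
  rw [star hz hαz hα hc hd] at hαcd
  rw [star hz hαz hα ha hc] at hα2
  rw [star hz' hβz hβ ha hb] at hβab
  rw [star hz' hβz hβ hb hc] at hβbc
  rw [star hz' hβz hβ hc hd] at hβcd
  rw [star hz' hβz hβ hb hd] at hβ2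
  -- The direction of `b` is equal or adjacent to those of `a` and `c`, which are two distinct
  -- leaves of the star, so it is the center.
  have hαb : T.next α b = z := by grind
  have hβc : T.next β c = z' := by grind
  have hne : α ≠ β := by
    rintro rfl
    have hzz : z = z' := by
      have := hαz.symm.trans hβz
      by_contra hzz
      grind
    grind
  have hv := fun v => T.next_eq_or hne v
  have hva := hv a; have hvb := hv b; have hvc := hv c; have hvd := hv d
  by_cases hcdα : T.next α c = T.next α d
  · have h1 : T.next α c = T.next α β := by grind
    have h2 : T.next β b = T.next β α := by grind
    refine ⟨α, β, hne, ?_, ⟨z, hz, hαz, by grind⟩, ⟨z', hz', hβz, by grind⟩⟩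
    -- Here `b` lies beyond `α` and `c` beyond `β`, so a node between `α` and `β` is also between
    -- `b` and `c`.
    intro ε hεα hεβ hεne
    have h3 := T.next_eq_or hεα.symm β
    have h4 : T.next α b ≠ T.next α β := by grind
    have h5 : T.next β c ≠ T.next β α := by grind
    have h6 : T.next ε b = T.next ε α := by
      have := T.next_eq_or hεα.symm b
      grind
    have h7 : T.next ε c = T.next ε β := by
      have := T.next_eq_or hεβ.symm c
      have := T.next_eq_or hεβ.symm α
      grind
    have h8 : T.IsInternalNode ε := isInternalNode_of_adj_of_adj (T.isTree.adj_next hεα)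
      (T.isTree.adj_next hεβ) hεne
    rw [← h6, ← h7] at hεne ⊢
    exact (hacc h8 hb hc hbc).resolve_left hεne
  -- Now the centers face each other, with `a, c` on the side of `α` and `b, d` on the side of `β`.
  -- No node `δ` can block `a, d`: `α` and `β` do not, and any other node between `a` and `d` sees
  -- them as it sees `a, b` or `c, d`.
  · exfalso
    obtain ⟨δ, hδ, hδ1, hδ2, -⟩ := hsep had
    have hδab := hacc hδ ha hb hab
    have hδcd := hacc hδ hc hd hcd
    have hdα : T.next α d = z := by grind
    have h1 : T.next β a = T.next β c := by grind
    have hδα : α ≠ δ := by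
      rintro rfl
      rw [hdα, ← hαb] at hδ1 hδ2
      grind
    have hδβ : β ≠ δ := by
      rintro rfl
      rw [h1] at hδ1 hδ2
      grind
    have k := fun v => T.next_eq_or hδα v
    have l := fun v => T.next_eq_or hδβ v
    have ka := k a; have kb := k b; have kc := k c; have kd := k d
    have la := l a; have lb := l b; have lc := l c; have ld := l d
    clear k l hv
    grind

/-- At an s-leaf `x` there are leaves `p` and `q` of the tree, reached from the center of the star
and from a leaf of the star other than `x`. -/
theorem exists_star_directions [Finite N] {x : T.Vertex} (hx : T.IsSLeaf x) :
    ∃ p q, T.IsLeafNode p ∧ T.IsLeafNode q ∧ x.fst ≠ p ∧ x.fst ≠ q ∧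
      T.Accessible x.fst p ∧ T.Accessible x.fst q ∧
      T.next x.fst p ≠ x.snd ∧ T.next x.fst q ≠ x.snd ∧
      T.LabelAdj x.fst (T.next x.fst p) x.snd ∧
      T.LabelAdj x.fst (T.next x.fst p) (T.next x.fst q) ∧
      ¬ T.LabelAdj x.fst (T.next x.fst q) x.snd := by
  obtain ⟨hint, ⟨z, hz⟩, hstar, hne⟩ := hx
  have hne : x.snd ≠ z := fun h => hne (Subtype.ext h)
  have hcard := hT.three_le_card _ hint
  obtain ⟨w, hw, hwn⟩ : ∃ w ∈ T.tree.neighborSet x.fst, w ∉ ({x.snd, z} : Set N) := by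
    refine Set.exists_mem_notMem_of_ncard_lt_ncard ?_ (Set.toFinite _)
    rw [Set.ncard_pair hne]
    omega
  simp only [Set.mem_insert_iff, Set.mem_singleton_iff, not_or] at hwn
  obtain ⟨p, hp, hp1, hp2, hp3⟩ :=
    exists_isLeafNode_accessible (fun ε hε => hT.label_connected hε) hz
  obtain ⟨q, hq, hq1, hq2, hq3⟩ :=
    exists_isLeafNode_accessible (fun ε hε => hT.label_connected hε) hw
  refine ⟨p, q, hp, hq, hp1, hq1, hp3, hq3, ?_⟩
  rw [hp2, hq2, labelAdj_iff_of_label_eq_starGraph hstar hz x.adj,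
    labelAdj_iff_of_label_eq_starGraph hstar hz hw,
    labelAdj_iff_of_label_eq_starGraph hstar hw x.adj]
  exact ⟨hne.symm, hwn.1, ⟨hne.symm, .inl rfl⟩, ⟨Ne.symm hwn.2, .inl rfl⟩,
    fun h => h.2.elim hwn.2 hne⟩

/-- Take `b`, `c` beyond the centers of the two stars and `a`, `d` beyond further leaves. The star
at `x` blocks `a` from `c` and `d`, the star at `y` blocks `b` from `d`, and `b` reaches `c` through
both centers. -/
theorem exists_leaves_of_sLeaf [Finite N] {x y : T.Vertex} (hx : T.IsSLeaf x) (hy : T.IsSLeaf y)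
    (hne : x.fst ≠ y.fst) (hxy : x.snd = T.next x.fst y.fst) (hyx : y.snd = T.next y.fst x.fst)
    (hacc : T.Accessible x.fst y.fst) :
    ∃ a b c d, (T.IsLeafNode a ∧ T.IsLeafNode b ∧ T.IsLeafNode c ∧ T.IsLeafNode d) ∧
      (a ≠ b ∧ b ≠ c ∧ c ≠ d) ∧ (T.Accessible a b ∧ T.Accessible b c ∧ T.Accessible c d) ∧
      ¬ T.Accessible a c ∧ ¬ T.Accessible b d ∧ ¬ T.Accessible a d := by
  obtain ⟨b, a, hb, ha, hxb, hxa, hacb, haca, hnb, hna, hbx, hba, hax⟩ :=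
    hT.exists_star_directions hx
  obtain ⟨c, d, hc, hd, hyc, hyd, hacc', hacd, hnc, hnd, hcy, hcd, hdy⟩ :=
    hT.exists_star_directions hy
  generalize x.fst = α at *
  generalize y.fst = β at *
  rw [hxy] at hnb hna hbx hax
  rw [hyx] at hnc hnd hcy hdy
  have hαc : T.next α c = T.next α β := (T.next_eq_or hne.symm c).resolve_left hnc
  have hαd : T.next α d = T.next α β := (T.next_eq_or hne.symm d).resolve_left hnd
  have hβb : T.next β b = T.next β α := (T.next_eq_or hne b).resolve_left hnb
  have hxc : α ≠ c := fun h => hnc (by rw [h])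
  have hxd : α ≠ d := fun h => hnd (by rw [h])
  have hyb : β ≠ b := fun h => hnb (by rw [h])
  have haccαc : T.Accessible α c :=
    (accessible_iff_labelAdj hne.symm hyc hnc.symm hacc.symm hacc').2 hcy.symm
  refine ⟨a, b, c, d, ⟨ha, hb, hc, hd⟩, ⟨?_, ?_, ?_⟩, ⟨?_, ?_, ?_⟩, ?_, ?_, ?_⟩
  · exact fun h => hba.ne (by rw [h])
  · exact fun h => hnb (by rw [h, hαc])
  · exact fun h => hcd.ne (by rw [h])
  · exact (accessible_iff_labelAdj hxa hxb hba.ne.symm haca hacb).2 hba.symm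
  · exact (accessible_iff_labelAdj hxb hxc (hαc ▸ hnb) hacb haccαc).2 (hαc ▸ hbx)
  · exact (accessible_iff_labelAdj hyc hyd hcd.ne hacc' hacd).2 hcd
  · exact fun h => hax (hαc ▸ h α hxa hxc (hαc ▸ hna))
  · exact fun h => hdy (hβb ▸ (h β hyb hyd (hβb ▸ hnd.symm)).symm)
  · exact fun h => hax (hαd ▸ h α hxa hxd (hαd ▸ hna))

end IsMinimalSplitDecompositionTree

end GraphLabelledTree

open SimpleGraph in
theorem mainTheorem3 {V : Type u} {N : Type v} [Finite V] [Finite N]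
    (G : SimpleGraph V) (hconn : G.Connected) (hdh : G.IsDistanceHereditary)
    (T : GraphLabelledTree N) (hT : T.IsMinimalSplitDecompositionTree G) :
    (SimpleGraph.pathGraph 4).IsIndContained G ↔
      ∃ (x y : T.Vertex) (p : T.graph.Walk x y), T.IsSLeafPath p := by
  obtain ⟨e⟩ := hT.accessibility_iso
  have hiso : (pathGraph 4).IsIndContained G ↔
      (pathGraph 4).IsIndContained T.accessibilityGraph :=
    ⟨fun ⟨f⟩ => ⟨f.trans e.symm.toEmbedding⟩, fun ⟨f⟩ => ⟨f.trans e.toEmbedding⟩⟩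
  rw [hiso, pathGraph_four_isIndContained_iff]
  simp only [GraphLabelledTree.exists_isSLeafPath_iff]
  constructor
  · rintro ⟨a, b, c, d, hab, hbc, hcd, hac, hbd, had⟩
    have hne1 : a ≠ c := by rintro rfl; exact had hcd
    have hne2 : b ≠ d := by rintro rfl; exact had hab
    have hne3 : a ≠ d := by rintro rfl; exact hac hcd.symm
    have hfst : ∀ {a b : {x : T.Vertex // T.IsLeafNode x.fst}}, a ≠ b → a.1.fst ≠ b.1.fst :=
      fun {a b} hab h => hab (Subtype.ext (GraphLabelledTree.vertex_ext h
        (a.2.eq_of_adj a.1.adj (h ▸ b.1.adj))))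
    rw [GraphLabelledTree.accessibilityGraph_adj] at hab hbc hcd hac hbd had
    obtain ⟨α, β, hne, hacc, ⟨z, hz, hαz, hαβ⟩, z', hz', hβz, hβα⟩ :=
      hT.exists_sLeaf_directions hdh a.2 b.2 c.2 d.2 hab.2 hbc.2 hcd.2
        (fun h => hac ⟨hfst hne1, h⟩) (fun h => hbd ⟨hfst hne2, h⟩) (fun h => had ⟨hfst hne3, h⟩)
    have h1 := T.isTree.adj_next hne
    have h2 := T.isTree.adj_next hne.symm
    exact ⟨⟨(α, T.next α β), h1⟩, ⟨(β, T.next β α), h2⟩,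
      ⟨GraphLabelledTree.isInternalNode_of_adj_of_adj h1 hz hαβ, _, hαz,
        fun h => hαβ (congrArg Subtype.val h)⟩,
      ⟨GraphLabelledTree.isInternalNode_of_adj_of_adj h2 hz' hβα, _, hβz,
        fun h => hβα (congrArg Subtype.val h)⟩, hne, rfl, rfl, hacc⟩
  · rintro ⟨x, y, hx, hy, hne, hxy, hyx, hacc⟩
    obtain ⟨a, b, c, d, ⟨ha, hb, hc, hd⟩, ⟨hab, hbc, hcd⟩, ⟨hab', hbc', hcd'⟩, hac, hbd, had⟩ :=
      hT.exists_leaves_of_sLeaf hx hy hne hxy hyx hacc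
    -- The node `v` serves only to name the unique vertex at the leaf `u`.
    let f : ∀ {u v : N}, T.IsLeafNode u → u ≠ v → {x : T.Vertex // T.IsLeafNode x.fst} :=
      fun {u v} hu huv => ⟨⟨(u, T.next u v), T.isTree.adj_next huv⟩, hu⟩
    refine ⟨f ha hab, f hb hbc, f hc hcd, f hd hcd.symm, ?_⟩
    simp only [GraphLabelledTree.accessibilityGraph_adj]
    exact ⟨⟨hab, hab'⟩, ⟨hbc, hbc'⟩, ⟨hcd, hcd'⟩, fun h => hac h.2, fun h => hbd h.2,
      fun h => had h.2⟩
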